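/- Let $(M,g_1)$ and $(B,g_2)$ be smooth finite-dimensional Riemannian manifolds, $\nabla^B$ the Levi-Civita connection of $B$, and let $(B,\psi,\xi,\eta,g_2)$ be a trans-Sasakian manifold of type $(\alpha,\beta)$. That is, $\dim B$ is odd, $\alpha,\beta$ are smooth functions on $B$, $\psi$ is a smooth $(1,1)$-tensor field, $\xi$ a smooth vector field and $\eta$ a smooth $1$-form with $$\psi^2=-I+\eta\otimes\xi,\quad \psi\xi=0,\quad \eta\circ\psi=0,\quad \eta(\xi)=1,$$ $$g_2(\psi X,\psi Z)=g_2(X,Z)-\eta(X)\eta(Z),\quad g_2(\psi X,Z)=-g_2(X,\psi Z),\quad \eta(X)=g_2(X,\xi),$$ $$(\nabla^B_X\psi)Z=\alpha\big(g_2(X,Z)\xi-\eta(Z)X\big)+\beta\big(g_2(\psi X,Z)\xi-\eta(Z)\psi X\big),$$ $$(\nabla^B_X\eta)Z=-\alpha g_2(\psi X,Z)+\beta g_2(\psi X,\psi Z),\quad \nabla^B_X\xi=-\alpha\psi X+\beta(X-\eta(X)\xi).$$ Let $\pi:M\to B$ be a smooth map with differential $\pi_*$ such that: * $\pi$ is a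 Riemannian map: for every $p\in M$, $g_2(\pi_*v,\pi_*w)=g_1(v,w)$ for all $v,w\in(\ker\pi_{*p})^\perp$; * $\pi$ is anti-invariant: $\psi(\mathrm{range}\,\pi_{*p})\subset(\mathrm{range}\,\pi_{*p})^\perp$ for every $p\in M$; * the Reeb field is horizontal: $\xi_{\pi(p)}\in(\mathrm{range}\,\pi_{*p})^\perp$ for every $p\in M$; * $\pi$ is Clairaut: there is a function $r:B\to(0,\infty)$ such that for every geodesic $\Omega:J\to B$ on an open interval $J$, the function $(r\circ\Omega)\sin\theta$, considered at the parameters $s$ at which $\Omega(s)=\pi(p)$ for some $p\in M$, is constant, where $\theta(s)$ is the angle between $\dot\Omega(s)$ and its component in $(\mathrm{range}\,\pi_{*p})^\perp$ (with $\theta(s)=\pi/2$, a right angle, if this component vanishes); * $\mathrm{range}\,\pi_*$ is integrable: for all open $N\subset M$ and $O\subset B$ with $\pi(N)\subset O$, if $X,Y$ are smooth vector fields on $O$ with $X_{\pi(q)},Y_{\pi(q)}\in\mathrm{range}\,\pi_{*q}$ for all $q\in N$, then $[X,Y]_{\pi(q)}\in\mathrm{range}\,\pi_{*q}$ for all $q\in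 N$. For a vector field $V$ along $\pi$ (a section of $\pi^{-1}TB$) and $w\in T_pM$, let $\nabla^{\pi\perp}_wV$ be the orthogonal projection on $(\mathrm{range}\,\pi_{*p})^\perp$ of the derivative of $V$ in direction $w$ for the pullback of $\nabla^B$ along $\pi$. For $U\in(\mathrm{range}\,\pi_{*p})^\perp$ let $\mathcal CU$ be the orthogonal projection of $\psi U$ on $(\mathrm{range}\,\pi_{*p})^\perp$. Then $$g_2\big(\nabla^{\pi\perp}_W\psi(\pi_*Y)-\nabla^{\pi\perp}_Y\psi(\pi_*W),\ \mathcal CU\big)=0$$ at every point $p\in M$, for all smooth sections $W,Y$ of $(\ker\pi_*)^\perp$ and all $U\in(\mathrm{range}\,\pi_{*p})^\perp$. -/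

import Mathlib

open scoped Manifold ContDiff Bundle
open Bundle (RiemannianBundle)

namespace ClairautMap

noncomputable section

/-! ### Riemannian geometry of the target -/

section Target

variable {E : Type*} [NormedAddCommGroup E] [NormedSpace ℝ E] [FiniteDimensional ℝ E]
  {B : Type*} [TopologicalSpace B] [ChartedSpace E B] [IsManifold 𝓘(ℝ, E) ∞ B]
  [RiemannianBundle (fun x : B ↦ TangentSpace 𝓘(ℝ, E) x)]
  [IsContMDiffRiemannianBundle 𝓘(ℝ, E) ∞ E (fun x : B ↦ TangentSpace 𝓘(ℝ, E) x)]

/-- The Levi-Civita connection: the torsion-free connection on the tangent bundle that is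
compatible with the Riemannian metric. Recall that `∇_w Z` at `x` is written `cov Z x w`. -/
structure IsLeviCivita
    (cov : CovariantDerivative 𝓘(ℝ, E) E (TangentSpace 𝓘(ℝ, E) : B → Type _)) : Prop where
  torsion_eq_zero : cov.torsion = 0
  metric : ∀ (Y Z : Π x : B, TangentSpace 𝓘(ℝ, E) x) (x : B) (w : TangentSpace 𝓘(ℝ, E) x),
    MDifferentiableAt 𝓘(ℝ, E) 𝓘(ℝ, E).tangent
      (fun y ↦ (⟨y, Y y⟩ : TangentBundle 𝓘(ℝ, E) B)) x →
    MDifferentiableAt 𝓘(ℝ, E) 𝓘(ℝ, E).tangent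
      (fun y ↦ (⟨y, Z y⟩ : TangentBundle 𝓘(ℝ, E) B)) x →
    mvfderiv 𝓘(ℝ, E) (fun y ↦ (inner ℝ (Y y) (Z y) : ℝ)) x w =
      inner ℝ (cov Y x w) (Z x) + inner ℝ (Y x) (cov Z x w)

/-- `(ψ, ξ, η, g)` is an almost contact metric structure on `B`, where `g` is the Riemannian
metric of `B`: `ψ` is a smooth `(1,1)`-tensor field, `ξ` a smooth vector field (the Reeb field),
`η` a smooth one-form, and the dimension of `B` is odd. -/
structure IsAlmostContactMetric
    (ψ : Π x : B, TangentSpace 𝓘(ℝ, E) x →L[ℝ] TangentSpace 𝓘(ℝ, E) x)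
    (ξ : Π x : B, TangentSpace 𝓘(ℝ, E) x)
    (η : Π x : B, TangentSpace 𝓘(ℝ, E) x →L[ℝ] ℝ) : Prop where
  odd_dim : Odd (Module.finrank ℝ E)
  smooth_psi : ContMDiff 𝓘(ℝ, E) (𝓘(ℝ, E).prod 𝓘(ℝ, E →L[ℝ] E)) ∞
    (fun x ↦ (⟨x, ψ x⟩ : Bundle.TotalSpace (E →L[ℝ] E)
      (fun x : B ↦ TangentSpace 𝓘(ℝ, E) x →L[ℝ] TangentSpace 𝓘(ℝ, E) x)))
  smooth_xi : ContMDiff 𝓘(ℝ, E) 𝓘(ℝ, E).tangent ∞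
    (fun x ↦ (⟨x, ξ x⟩ : TangentBundle 𝓘(ℝ, E) B))
  smooth_eta : ContMDiff 𝓘(ℝ, E) (𝓘(ℝ, E).prod 𝓘(ℝ, E →L[ℝ] ℝ)) ∞
    (fun x ↦ (⟨x, η x⟩ : Bundle.TotalSpace (E →L[ℝ] ℝ)
      (fun x : B ↦ TangentSpace 𝓘(ℝ, E) x →L[ℝ] Bundle.Trivial B ℝ x)))
  psi_sq : ∀ x v, ψ x (ψ x v) = -v + η x v • ξ x
  psi_xi : ∀ x, ψ x (ξ x) = 0
  eta_psi : ∀ x v, η x (ψ x v) = 0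
  eta_xi : ∀ x, η x (ξ x) = 1
  inner_psi_psi : ∀ x v w, inner ℝ (ψ x v) (ψ x w) = inner ℝ v w - η x v * η x w
  inner_psi_left : ∀ x v w, inner ℝ (ψ x v) w = -inner ℝ v (ψ x w)
  eta_eq_inner : ∀ x v, η x v = inner ℝ v (ξ x)

/-- `(B, ψ, ξ, η, g)` is a trans-Sasakian manifold of type `(α, β)`; `cov` is meant to be the
Levi-Civita connection of `B`. Here `(∇_w ψ) Z = ∇_w (ψ Z) - ψ (∇_w Z)` and
`(∇_w η) Z = w (η Z) - η (∇_w Z)`, for a tangent vector `w` at `x` and a vector field `Z` that is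
differentiable at `x`. -/
structure IsTransSasakian
    (cov : CovariantDerivative 𝓘(ℝ, E) E (TangentSpace 𝓘(ℝ, E) : B → Type _))
    (ψ : Π x : B, TangentSpace 𝓘(ℝ, E) x →L[ℝ] TangentSpace 𝓘(ℝ, E) x)
    (ξ : Π x : B, TangentSpace 𝓘(ℝ, E) x)
    (η : Π x : B, TangentSpace 𝓘(ℝ, E) x →L[ℝ] ℝ)
    (α β : B → ℝ) : Prop extends IsAlmostContactMetric ψ ξ η where
  smooth_alpha : ContMDiff 𝓘(ℝ, E) 𝓘(ℝ, ℝ) ∞ α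
  smooth_beta : ContMDiff 𝓘(ℝ, E) 𝓘(ℝ, ℝ) ∞ β
  cov_psi : ∀ (Z : Π x : B, TangentSpace 𝓘(ℝ, E) x) (x : B) (w : TangentSpace 𝓘(ℝ, E) x),
    MDifferentiableAt 𝓘(ℝ, E) 𝓘(ℝ, E).tangent
      (fun y ↦ (⟨y, Z y⟩ : TangentBundle 𝓘(ℝ, E) B)) x →
    cov (fun y ↦ ψ y (Z y)) x w - ψ x (cov Z x w) =
      α x • ((inner ℝ w (Z x) : ℝ) • ξ x - η x (Z x) • w)
        + β x • ((inner ℝ (ψ x w) (Z x) : ℝ) • ξ x - η x (Z x) • ψ x w)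
  cov_eta : ∀ (Z : Π x : B, TangentSpace 𝓘(ℝ, E) x) (x : B) (w : TangentSpace 𝓘(ℝ, E) x),
    MDifferentiableAt 𝓘(ℝ, E) 𝓘(ℝ, E).tangent
      (fun y ↦ (⟨y, Z y⟩ : TangentBundle 𝓘(ℝ, E) B)) x →
    mvfderiv 𝓘(ℝ, E) (fun y ↦ η y (Z y)) x w - η x (cov Z x w) =
      -α x * inner ℝ (ψ x w) (Z x) + β x * inner ℝ (ψ x w) (ψ x (Z x))
  cov_xi : ∀ (x : B) (w : TangentSpace 𝓘(ℝ, E) x),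
    cov ξ x w = -(α x • ψ x w) + β x • (w - η x w • ξ x)

/-- The pullback connection `∇^f` along a map `f : N → B`, on sections `s` of `f⁻¹ TB` (vector
fields along `f`): in the trivialization of `TB` over the preferred chart at `f q`, with coordinate
frame `e_i` and `s = ∑ sⁱ (e_i ∘ f)`, it is
`∇^f_v s = ∑ ds^i(v) e_i + ∑ sⁱ(q) ∇_{df(v)} e_i`.
Here `FiberBundle.extend E (s q)` is the local field `∑ sⁱ(q) e_i` with constant coefficients. -/
def covAlong (cov : CovariantDerivative 𝓘(ℝ, E) E (TangentSpace 𝓘(ℝ, E) : B → Type _))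
    {F : Type*} [NormedAddCommGroup F] [NormedSpace ℝ F]
    {N : Type*} [TopologicalSpace N] [ChartedSpace F N]
    (f : N → B) (s : Π q : N, TangentSpace 𝓘(ℝ, E) (f q)) (q : N)
    (v : TangentSpace 𝓘(ℝ, F) q) : TangentSpace 𝓘(ℝ, E) (f q) :=
  (trivializationAt E (TangentSpace 𝓘(ℝ, E) : B → Type _) (f q)).symm (f q)
      (mvfderiv 𝓘(ℝ, F) (fun q' ↦
        ((trivializationAt E (TangentSpace 𝓘(ℝ, E) : B → Type _) (f q))
          (⟨f q', s q'⟩ : TangentBundle 𝓘(ℝ, E) B)).2) q v)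
    + cov (FiberBundle.extend E (s q)) (f q) (mfderiv 𝓘(ℝ, F) 𝓘(ℝ, E) f q v)

/-- The velocity field of a curve. -/
def velocity (Ω : ℝ → B) (t : ℝ) : TangentSpace 𝓘(ℝ, E) (Ω t) :=
  mfderiv 𝓘(ℝ, ℝ) 𝓘(ℝ, E) Ω t (1 : ℝ)

/-- `Ω` is a geodesic on the open set `J` of parameters: it is smooth there and
`∇_{d/dt} Ω' = 0`. -/
def IsGeodesicOn (cov : CovariantDerivative 𝓘(ℝ, E) E (TangentSpace 𝓘(ℝ, E) : B → Type _))
    (Ω : ℝ → B) (J : Set ℝ) : Prop :=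
  ContMDiffOn 𝓘(ℝ, ℝ) 𝓘(ℝ, E) ∞ Ω J ∧
    ∀ t ∈ J, covAlong cov Ω (velocity (E := E) Ω) t (1 : ℝ) = 0

end Target

/-! ### Riemannian maps -/

section Maps

variable {E₁ : Type*} [NormedAddCommGroup E₁] [NormedSpace ℝ E₁] [FiniteDimensional ℝ E₁]
  {M : Type*} [TopologicalSpace M] [ChartedSpace E₁ M] [IsManifold 𝓘(ℝ, E₁) ∞ M]
  [RiemannianBundle (fun x : M ↦ TangentSpace 𝓘(ℝ, E₁) x)]
  [IsContMDiffRiemannianBundle 𝓘(ℝ, E₁) ∞ E₁ (fun x : M ↦ TangentSpace 𝓘(ℝ, E₁) x)]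
  {E : Type*} [NormedAddCommGroup E] [NormedSpace ℝ E] [FiniteDimensional ℝ E]
  {B : Type*} [TopologicalSpace B] [ChartedSpace E B] [IsManifold 𝓘(ℝ, E) ∞ B]
  [RiemannianBundle (fun x : B ↦ TangentSpace 𝓘(ℝ, E) x)]
  [IsContMDiffRiemannianBundle 𝓘(ℝ, E) ∞ E (fun x : B ↦ TangentSpace 𝓘(ℝ, E) x)]

/-- The range of `f_{*p}`, a subspace of `T_{f p} B`. -/
def rangeAt (E₁ E : Type*) [NormedAddCommGroup E₁] [NormedSpace ℝ E₁]
    {M : Type*} [TopologicalSpace M] [ChartedSpace E₁ M]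
    [NormedAddCommGroup E] [NormedSpace ℝ E]
    {B : Type*} [TopologicalSpace B] [ChartedSpace E B]
    (f : M → B) (p : M) : Submodule ℝ (TangentSpace 𝓘(ℝ, E) (f p)) :=
  LinearMap.range (mfderiv 𝓘(ℝ, E₁) 𝓘(ℝ, E) f p).toLinearMap

/-- The horizontal space `(ker f_{*p})^⊥`, a subspace of `T_p M`. -/
def horizontalAt (E₁ E : Type*) [NormedAddCommGroup E₁] [NormedSpace ℝ E₁]
    {M : Type*} [TopologicalSpace M] [ChartedSpace E₁ M] [IsManifold 𝓘(ℝ, E₁) ∞ M]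
    [RiemannianBundle (fun x : M ↦ TangentSpace 𝓘(ℝ, E₁) x)]
    [NormedAddCommGroup E] [NormedSpace ℝ E]
    {B : Type*} [TopologicalSpace B] [ChartedSpace E B]
    (f : M → B) (p : M) : Submodule ℝ (TangentSpace 𝓘(ℝ, E₁) p) :=
  (LinearMap.ker (mfderiv 𝓘(ℝ, E₁) 𝓘(ℝ, E) f p).toLinearMap)ᗮ

instance (f : M → B) (p : M) : (rangeAt E₁ E f p).HasOrthogonalProjection := by
  have : FiniteDimensional ℝ (TangentSpace 𝓘(ℝ, E) (f p)) :=
    inferInstanceAs (FiniteDimensional ℝ E)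
  infer_instance

/-- A smooth map `f : M → B` is a Riemannian map if each `f_{*p}` is isometric on the horizontal
space `(ker f_{*p})^⊥`. -/
structure IsRiemannianMap (f : M → B) : Prop where
  smooth : ContMDiff 𝓘(ℝ, E₁) 𝓘(ℝ, E) ∞ f
  isometric : ∀ (p : M), ∀ v ∈ horizontalAt E₁ E f p, ∀ w ∈ horizontalAt E₁ E f p,
    (inner ℝ (mfderiv 𝓘(ℝ, E₁) 𝓘(ℝ, E) f p v) (mfderiv 𝓘(ℝ, E₁) 𝓘(ℝ, E) f p w) : ℝ) = inner ℝ v w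

/-- Anti-invariance: `ψ (range f_{*p}) ⊆ (range f_{*p})^⊥` for all `p`. -/
def IsAntiInvariant (f : M → B)
    (ψ : Π x : B, TangentSpace 𝓘(ℝ, E) x →L[ℝ] TangentSpace 𝓘(ℝ, E) x) : Prop :=
  ∀ (p : M), ∀ v ∈ rangeAt E₁ E f p, ψ (f p) v ∈ (rangeAt E₁ E f p)ᗮ

/-- The angle between a vector `u` of `T_b B` and its component in `(range f_{*p})^⊥`, at a point
`b = f p` of the image of `f`. (If that component vanishes, the angle is a right angle.) -/
def clairautAngle (f : M → B) (p : M) {b : B} (h : f p = b) (u : TangentSpace 𝓘(ℝ, E) b) : ℝ :=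
  let u' : TangentSpace 𝓘(ℝ, E) (f p) := h ▸ u
  InnerProductGeometry.angle u' ((rangeAt E₁ E f p)ᗮ.starProjection u')

/-- The Clairaut condition: there is a positive function `r` on `B` such that, for every geodesic
`Ω : J → B` on an open interval, the function `(r ∘ Ω) sin θ` is constant; here `θ` is the angle
between `Ω'` and its component in `(range f_*)^⊥`, and the function is considered at all parameters
where it is defined, that is, where `Ω` meets the image of `f`. -/
def IsClairaut (cov : CovariantDerivative 𝓘(ℝ, E) E (TangentSpace 𝓘(ℝ, E) : B → Type _))
    (f : M → B) : Prop :=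
  ∃ r : B → ℝ, (∀ b, 0 < r b) ∧
    ∀ (J : Set ℝ) (Ω : ℝ → B), IsOpen J → J.OrdConnected → IsGeodesicOn cov Ω J →
      ∃ c : ℝ, ∀ t ∈ J, ∀ (p : M) (h : f p = Ω t),
        r (Ω t) * Real.sin (clairautAngle (E₁ := E₁) f p h (velocity (E := E) Ω t)) = c

/-- Integrability (involutivity) of `range f_*`: the Lie bracket of two local vector fields of `B`
that take values in `range f_*` along `f` (over an open set `N` of `M`) again takes values in
`range f_*` there. -/
def IsIntegrableRange (E₁ E : Type*) [NormedAddCommGroup E₁] [NormedSpace ℝ E₁]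
    {M : Type*} [TopologicalSpace M] [ChartedSpace E₁ M]
    [NormedAddCommGroup E] [NormedSpace ℝ E]
    {B : Type*} [TopologicalSpace B] [ChartedSpace E B] [IsManifold 𝓘(ℝ, E) ∞ B]
    (f : M → B) : Prop :=
  ∀ (N : Set M) (O : Set B), IsOpen N → IsOpen O → Set.MapsTo f N O →
    ∀ X Y : Π x : B, TangentSpace 𝓘(ℝ, E) x,
      ContMDiffOn 𝓘(ℝ, E) 𝓘(ℝ, E).tangent ∞ (fun x ↦ (⟨x, X x⟩ : TangentBundle 𝓘(ℝ, E) B)) O →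
      ContMDiffOn 𝓘(ℝ, E) 𝓘(ℝ, E).tangent ∞ (fun x ↦ (⟨x, Y x⟩ : TangentBundle 𝓘(ℝ, E) B)) O →
      (∀ q ∈ N, X (f q) ∈ rangeAt E₁ E f q) → (∀ q ∈ N, Y (f q) ∈ rangeAt E₁ E f q) →
      ∀ q ∈ N, VectorField.mlieBracket 𝓘(ℝ, E) X Y (f q) ∈ rangeAt E₁ E f q

/-- `W` is a smooth horizontal vector field on `M`, a section of `(ker f_*)^⊥`. -/
structure IsHorizontalField (E : Type*) [NormedAddCommGroup E] [NormedSpace ℝ E]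
    {B : Type*} [TopologicalSpace B] [ChartedSpace E B]
    (f : M → B) (W : Π p : M, TangentSpace 𝓘(ℝ, E₁) p) : Prop where
  smooth : ContMDiff 𝓘(ℝ, E₁) 𝓘(ℝ, E₁).tangent ∞
    (fun p ↦ (⟨p, W p⟩ : TangentBundle 𝓘(ℝ, E₁) M))
  horizontal : ∀ p, W p ∈ horizontalAt E₁ E f p

/-- The section `f_* W` of `f⁻¹ TB`. -/
def push (E : Type*) [NormedAddCommGroup E] [NormedSpace ℝ E]
    {B : Type*} [TopologicalSpace B] [ChartedSpace E B]
    (f : M → B) (W : Π p : M, TangentSpace 𝓘(ℝ, E₁) p) (p : M) : TangentSpace 𝓘(ℝ, E) (f p) :=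
  mfderiv 𝓘(ℝ, E₁) 𝓘(ℝ, E) f p (W p)

/-- `∇^{f⊥}_w V`: the component in `(range f_*)^⊥` of the derivative `∇^f_w V` of a vector field
`V` along `f`. -/
def normalCov (cov : CovariantDerivative 𝓘(ℝ, E) E (TangentSpace 𝓘(ℝ, E) : B → Type _))
    (f : M → B) (V : Π p : M, TangentSpace 𝓘(ℝ, E) (f p)) (p : M)
    (w : TangentSpace 𝓘(ℝ, E₁) p) : TangentSpace 𝓘(ℝ, E) (f p) :=
  (rangeAt E₁ E f p)ᗮ.starProjection (covAlong cov f V p w)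

/-- `𝒞U`: the component of `ψ U` in `(range f_{*p})^⊥`, for a tangent vector `U` at `f p`. -/
def normalPart (E₁ : Type*) [NormedAddCommGroup E₁] [NormedSpace ℝ E₁] [FiniteDimensional ℝ E₁]
    {M : Type*} [TopologicalSpace M] [ChartedSpace E₁ M] (f : M → B)
    (ψ : Π x : B, TangentSpace 𝓘(ℝ, E) x →L[ℝ] TangentSpace 𝓘(ℝ, E) x) (p : M)
    (U : TangentSpace 𝓘(ℝ, E) (f p)) : TangentSpace 𝓘(ℝ, E) (f p) :=
  (rangeAt E₁ E f p)ᗮ.starProjection (ψ (f p) U)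

end Maps

end

end ClairautMap

/-! Differentiating `ψ (π_* Y)` along `π` gives `ψ (∇_W π_* Y) + (∇_W ψ)(π_* Y)`. In the
trans-Sasakian formula for `(∇_W ψ)(π_* Y)`, the terms with `η (π_* Y)` vanish because `ξ` is normal
to the range, and the term with `g₂(ψ π_* W, π_* Y)` vanishes by anti-invariance. What remains, `α
g₂(π_* W, π_* Y) ξ`, is symmetric in `W` and `Y`, so it drops out after antisymmetrizing, leaving `ψ
v` with `v = ∇_W π_* Y - ∇_Y π_* W`.

Since the connection is torsion-free, `v` is morally `π_* [W, Y]`; only its membership in the range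
is needed (`covAlong_push_sub_mem_rangeAt`). Then `ψ v` is normal, so its pairing with `𝒞U` is `g₂(ψ
v, ψ U) = g₂(v, U) - η(v) η(U) = 0`.

A field along `π` need not extend to a field on `B`, so the Leibniz rule for `ψ` along `π`
(`covAlong_endomorphism_apply`) is proved in coordinates. -/

namespace ClairautMap

/-! ### Derivatives of vector-valued functions on manifolds. -/

section Calculus

variable {F : Type*} [NormedAddCommGroup F] [NormedSpace ℝ F]
  {N : Type*} [TopologicalSpace N] [ChartedSpace F N]
  {V V' : Type*} [NormedAddCommGroup V] [NormedSpace ℝ V]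
  [NormedAddCommGroup V'] [NormedSpace ℝ V']

theorem mvfderiv_congr_of_eventuallyEq {g h : N → V} {q : N} (hgh : g =ᶠ[nhds q] h) :
    mvfderiv 𝓘(ℝ, F) g q = mvfderiv 𝓘(ℝ, F) h q := by
  have key := hgh.mfderiv_eq (I := 𝓘(ℝ, F)) (I' := 𝓘(ℝ, V))
  exact key

theorem mdifferentiableAt_iff_differentiableAt_extChartAt_symm [IsManifold 𝓘(ℝ, F) 1 N] {g : N → V}
    {q : N} : MDifferentiableAt 𝓘(ℝ, F) 𝓘(ℝ, V) g q ↔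
      DifferentiableAt ℝ (g ∘ (extChartAt 𝓘(ℝ, F) q).symm) (extChartAt 𝓘(ℝ, F) q q) := by
  rw [← mdifferentiableWithinAt_univ]
  constructor
  · intro h
    have := h.differentiableWithinAt_comp_extChartAt_symm
    simp only [Set.preimage_univ, Set.univ_inter, modelWithCornersSelf_coe, Set.range_id] at this
    exact differentiableWithinAt_univ.1 this
  · intro h
    apply DifferentiableWithinAt.mdifferentiableWithinAt_of_comp_extChartAt_symm
    exact h.differentiableWithinAt

theorem mvfderiv_eq_fderiv {g : N → V} {q : N} (hg : MDifferentiableAt 𝓘(ℝ, F) 𝓘(ℝ, V) g q) :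
    mvfderiv 𝓘(ℝ, F) g q =
      fderiv ℝ (g ∘ (extChartAt 𝓘(ℝ, F) q).symm) (extChartAt 𝓘(ℝ, F) q q) := by
  rw [hg.mvfderiv]
  simp only [modelWithCornersSelf_coe, Set.range_id, fderivWithin_univ]
  rfl

theorem mvfderiv_clm_apply [IsManifold 𝓘(ℝ, F) 1 N] {A : N → V →L[ℝ] V'} {g : N → V} {q : N}
    (hA : MDifferentiableAt 𝓘(ℝ, F) 𝓘(ℝ, V →L[ℝ] V') A q)
    (hg : MDifferentiableAt 𝓘(ℝ, F) 𝓘(ℝ, V) g q) (v : TangentSpace 𝓘(ℝ, F) q) :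
    mvfderiv 𝓘(ℝ, F) (fun q' ↦ A q' (g q')) q v =
      mvfderiv 𝓘(ℝ, F) A q v (g q) + A q (mvfderiv 𝓘(ℝ, F) g q v) := by
  rw [mvfderiv_eq_fderiv (hA.clm_apply hg), mvfderiv_eq_fderiv hA, mvfderiv_eq_fderiv hg]
  have hA' := mdifferentiableAt_iff_differentiableAt_extChartAt_symm.1 hA
  have hg' := mdifferentiableAt_iff_differentiableAt_extChartAt_symm.1 hg
  have := fderiv_clm_apply hA' hg'
  have h2 := congrArg (fun T ↦ T v) this
  simp only [Function.comp_apply, extChartAt_to_inv] at h2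
  rw [add_comm]
  exact h2

theorem mvfderiv_comp_apply_vector {F' : Type*} [NormedAddCommGroup F'] [NormedSpace ℝ F']
    {N' : Type*} [TopologicalSpace N'] [ChartedSpace F' N'] {g : N' → V} {f : N → N'} {q : N}
    (hg : MDifferentiableAt 𝓘(ℝ, F') 𝓘(ℝ, V) g (f q))
    (hf : MDifferentiableAt 𝓘(ℝ, F) 𝓘(ℝ, F') f q) (v : TangentSpace 𝓘(ℝ, F) q) :
    mvfderiv 𝓘(ℝ, F) (fun q' ↦ g (f q')) q v =
      mvfderiv 𝓘(ℝ, F') g (f q) (mfderiv 𝓘(ℝ, F) 𝓘(ℝ, F') f q v) :=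
  mfderiv_comp_apply q hg hf v

end Calculus

/-! ### A connection as flat derivative plus Christoffel term. -/

section Connection

open FiberBundle

variable {E : Type*} [NormedAddCommGroup E] [NormedSpace ℝ E] [FiniteDimensional ℝ E]
  {B : Type*} [TopologicalSpace B] [ChartedSpace E B] [IsManifold 𝓘(ℝ, E) ∞ B]

/-- The connection minus the flat derivative of a trivialization is tensorial, so it sees only the
value `Z x`. It may be evaluated on the extension of `Z x` with constant coefficients, whose flat
derivative is zero. This is the case of the identity map in the formula defining `covAlong`. -/
theorem cov_apply_eq_add (cov : CovariantDerivative 𝓘(ℝ, E) E (TangentSpace 𝓘(ℝ, E) : B → Type _))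
    {Z : Π x : B, TangentSpace 𝓘(ℝ, E) x} {x : B}
    (hZ : MDifferentiableAt 𝓘(ℝ, E) 𝓘(ℝ, E).tangent
      (fun y ↦ (⟨y, Z y⟩ : TangentBundle 𝓘(ℝ, E) B)) x) (w : TangentSpace 𝓘(ℝ, E) x) :
    cov Z x w = (trivializationAt E (TangentSpace 𝓘(ℝ, E) : B → Type _) x).symm x
        (mvfderiv 𝓘(ℝ, E) (fun y ↦ ((trivializationAt E (TangentSpace 𝓘(ℝ, E) : B → Type _) x)
          (⟨y, Z y⟩ : TangentBundle 𝓘(ℝ, E) B)).2) x w) + cov (extend E (Z x)) x w := by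
  have : IsManifold 𝓘(ℝ, E) 1 B := .of_le (n := ∞) (by simp)
  set e := trivializationAt E (TangentSpace 𝓘(ℝ, E) : B → Type _) x with he
  have hx : x ∈ e.baseSet := mem_baseSet_trivializationAt' x
  have hnhds : ∀ᶠ y in nhds x, y ∈ e.baseSet := e.open_baseSet.mem_nhds hx
  let Φ : (Π x : B, TangentSpace 𝓘(ℝ, E) x) → TangentSpace 𝓘(ℝ, E) x := fun Z ↦
    cov Z x w - e.symmL ℝ x (mvfderiv 𝓘(ℝ, E) (fun y ↦ (e (⟨y, Z y⟩ : TangentBundle 𝓘(ℝ, E) B)).2) x w)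
  have hΦ : TensorialAt 𝓘(ℝ, E) E Φ x := by
    constructor
    · intro f σ hf hσ
      have hσ' := (mdifferentiableAt_section 𝓘(ℝ, E) σ).1 hσ
      have h1 : (fun y ↦ (e (⟨y, (f • σ) y⟩ : TangentBundle 𝓘(ℝ, E) B)).2) =ᶠ[nhds x]
          f • (fun y ↦ (e (⟨y, σ y⟩ : TangentBundle 𝓘(ℝ, E) B)).2) := by
        filter_upwards [hnhds] with y hy
        exact (e.linear ℝ hy).2 (f y) (σ y)
      simp only [Φ]
      rw [mvfderiv_congr_of_eventuallyEq h1, mvfderiv_smul hf hσ',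
        cov.isCovariantDerivativeOnUniv.leibniz hσ hf]
      simp only [add_apply, smul_apply,
        ContinuousLinearMap.smulRight_apply, map_add, map_smul]
      -- Both Leibniz rules produce the derivative of `f` times `σ x`; this identity makes the two
      -- terms cancel.
      have h2 : e.symmL ℝ x (e (⟨x, σ x⟩ : TangentBundle 𝓘(ℝ, E) B)).2 = σ x := by
        rw [e.symmL_apply hx]
        exact e.symm_apply_apply_mk hx (σ x)
      rw [h2]
      module
    · intro σ τ hσ hτ
      have hσ' := (mdifferentiableAt_section 𝓘(ℝ, E) σ).1 hσ
      have hτ' := (mdifferentiableAt_section 𝓘(ℝ, E) τ).1 hτ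
      have h1 : (fun y ↦ (e (⟨y, (σ + τ) y⟩ : TangentBundle 𝓘(ℝ, E) B)).2) =ᶠ[nhds x]
          (fun y ↦ (e (⟨y, σ y⟩ : TangentBundle 𝓘(ℝ, E) B)).2) +
          (fun y ↦ (e (⟨y, τ y⟩ : TangentBundle 𝓘(ℝ, E) B)).2) := by
        filter_upwards [hnhds] with y hy
        exact (e.linear ℝ hy).1 (σ y) (τ y)
      simp only [Φ]
      rw [mvfderiv_congr_of_eventuallyEq h1, mvfderiv_add hσ' hτ',
        cov.isCovariantDerivativeOnUniv.add hσ hτ]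
      simp only [add_apply, map_add]
      module
  have key := hΦ.pointwise hZ (mdifferentiableAt_extend 𝓘(ℝ, E) E (Z x)) (by simp)
  have hconst : (fun y ↦ (e (⟨y, extend E (Z x) y⟩ : TangentBundle 𝓘(ℝ, E) B)).2) =ᶠ[nhds x]
      fun _ ↦ (e (⟨x, Z x⟩ : TangentBundle 𝓘(ℝ, E) B)).2 := by
    filter_upwards [hnhds] with y hy
    exact e.apply_mk_symm hy _ ▸ rfl
  simp only [Φ] at key
  rw [mvfderiv_congr_of_eventuallyEq hconst, mvfderiv_const, e.symmL_apply hx] at key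
  simp only [zero_apply, map_zero, sub_zero] at key
  rw [← key]
  abel

end Connection
-- Fibrewise linear maps in tangent coordinates.
section Coordinates

variable {E : Type*} [NormedAddCommGroup E] [NormedSpace ℝ E]
  {B : Type*} [TopologicalSpace B] [ChartedSpace E B] [IsManifold 𝓘(ℝ, E) 1 B]
  {F : Type*} [NormedAddCommGroup F] [NormedSpace ℝ F]
  {N : Type*} [TopologicalSpace N] [ChartedSpace F N] [IsManifold 𝓘(ℝ, F) 1 N]

theorem trivializationAt_clm_apply {x₀ x : N} {y₀ y : B}
    (hx : x ∈ (chartAt F x₀).source) (hy : y ∈ (chartAt E y₀).source)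
    (ϕ : TangentSpace 𝓘(ℝ, F) x →L[ℝ] TangentSpace 𝓘(ℝ, E) y) (u : TangentSpace 𝓘(ℝ, F) x) :
    ((trivializationAt E (TangentSpace 𝓘(ℝ, E) : B → Type _) y₀)
        (⟨y, ϕ u⟩ : TangentBundle 𝓘(ℝ, E) B)).2 =
      ContinuousLinearMap.inCoordinates F (TangentSpace 𝓘(ℝ, F) : N → Type _) E
        (TangentSpace 𝓘(ℝ, E) : B → Type _) x₀ x y₀ y ϕ
        ((trivializationAt F (TangentSpace 𝓘(ℝ, F) : N → Type _) x₀)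
          (⟨x, u⟩ : TangentBundle 𝓘(ℝ, F) N)).2 := by
  have hx' : x ∈ (trivializationAt F (TangentSpace 𝓘(ℝ, F) : N → Type _) x₀).baseSet := hx
  have hy' : y ∈ (trivializationAt E (TangentSpace 𝓘(ℝ, E) : B → Type _) y₀).baseSet := hy
  simp only [ContinuousLinearMap.inCoordinates, ContinuousLinearMap.comp_apply]
  rw [Bundle.Trivialization.symmL_apply _ hx', Bundle.Trivialization.symm_apply_apply_mk _ hx',
    Bundle.Trivialization.continuousLinearMapAt_apply_of_mem ℝ _ hy']

theorem trivializationAt_symm_inCoordinates {x₀ x : N} {y₀ y : B}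
    (hx : x ∈ (chartAt F x₀).source) (hy : y ∈ (chartAt E y₀).source)
    (ϕ : TangentSpace 𝓘(ℝ, F) x →L[ℝ] TangentSpace 𝓘(ℝ, E) y) (c : F) :
    (trivializationAt E (TangentSpace 𝓘(ℝ, E) : B → Type _) y₀).symm y
      (ContinuousLinearMap.inCoordinates F (TangentSpace 𝓘(ℝ, F) : N → Type _) E
        (TangentSpace 𝓘(ℝ, E) : B → Type _) x₀ x y₀ y ϕ c) =
      ϕ ((trivializationAt F (TangentSpace 𝓘(ℝ, F) : N → Type _) x₀).symm x c) := by
  have hx' : x ∈ (trivializationAt F (TangentSpace 𝓘(ℝ, F) : N → Type _) x₀).baseSet := hx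
  have hy' : y ∈ (trivializationAt E (TangentSpace 𝓘(ℝ, E) : B → Type _) y₀).baseSet := hy
  simp only [ContinuousLinearMap.inCoordinates, ContinuousLinearMap.comp_apply]
  rw [Bundle.Trivialization.symmL_apply _ hx',
    Bundle.Trivialization.continuousLinearMapAt_apply_of_mem ℝ _ hy']
  exact Bundle.Trivialization.symm_apply_apply_mk _ hy' _

theorem trivializationAt_apply_self (x : N) (u : TangentSpace 𝓘(ℝ, F) x) :
    ((trivializationAt F (TangentSpace 𝓘(ℝ, F) : N → Type _) x)
      (⟨x, u⟩ : TangentBundle 𝓘(ℝ, F) N)).2 = u :=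
  (tangentBundleCore 𝓘(ℝ, F) N).coordChange_self (achart F x) x (mem_chart_source F x) u

end Coordinates

/-! ### The pullback connection: Leibniz rule and symmetry. -/

section Along

open FiberBundle

variable {E : Type*} [NormedAddCommGroup E] [NormedSpace ℝ E]
  {B : Type*} [TopologicalSpace B] [ChartedSpace E B] [IsManifold 𝓘(ℝ, E) ∞ B]

/-- With `A` the matrix of `ψ` in the frame at `f q`, the product rule for `(A ∘ f) s` splits into
`A` applied to the derivative of `s`, and the derivative of `A` along `df v` applied to `s q`. The
second piece, combined with the Christoffel terms, is `(∇_{df v} ψ)(s q)`, which is tensorial and is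
therefore written with the constant-coefficient extension of `s q`. -/
theorem covAlong_endomorphism_apply [FiniteDimensional ℝ E]
    (cov : CovariantDerivative 𝓘(ℝ, E) E (TangentSpace 𝓘(ℝ, E) : B → Type _))
    {ψ : Π x : B, TangentSpace 𝓘(ℝ, E) x →L[ℝ] TangentSpace 𝓘(ℝ, E) x}
    {F : Type*} [NormedAddCommGroup F] [NormedSpace ℝ F]
    {N : Type*} [TopologicalSpace N] [ChartedSpace F N] [IsManifold 𝓘(ℝ, F) 1 N]
    {f : N → B} {s : Π q : N, TangentSpace 𝓘(ℝ, E) (f q)} {q : N}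
    (hψ : MDifferentiableAt 𝓘(ℝ, E) (𝓘(ℝ, E).prod 𝓘(ℝ, E →L[ℝ] E))
      (fun x ↦ (⟨x, ψ x⟩ : Bundle.TotalSpace (E →L[ℝ] E)
        (fun x : B ↦ TangentSpace 𝓘(ℝ, E) x →L[ℝ] TangentSpace 𝓘(ℝ, E) x))) (f q))
    (hf : MDifferentiableAt 𝓘(ℝ, F) 𝓘(ℝ, E) f q)
    (hs : MDifferentiableAt 𝓘(ℝ, F) 𝓘(ℝ, E).tangent
      (fun q' ↦ (⟨f q', s q'⟩ : TangentBundle 𝓘(ℝ, E) B)) q)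
    (v : TangentSpace 𝓘(ℝ, F) q) :
    covAlong cov f (fun q' ↦ ψ (f q') (s q')) q v =
      ψ (f q) (covAlong cov f s q v) +
        (cov (fun y ↦ ψ y (extend E (s q) y)) (f q) (mfderiv 𝓘(ℝ, F) 𝓘(ℝ, E) f q v) -
          ψ (f q) (cov (extend E (s q)) (f q) (mfderiv 𝓘(ℝ, F) 𝓘(ℝ, E) f q v))) := by
  have : IsManifold 𝓘(ℝ, E) 1 B := .of_le (n := ∞) (by simp)
  have hψ' := ((mdifferentiableAt_hom_bundle _).1 hψ).2
  have hs' := ((mdifferentiableAt_totalSpace _ _).1 hs).2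
  have hext := mdifferentiableAt_extend 𝓘(ℝ, E) E (s q)
  have hψext : MDifferentiableAt 𝓘(ℝ, E) 𝓘(ℝ, E).tangent
      (fun y ↦ (⟨y, ψ y (extend E (s q) y)⟩ : TangentBundle 𝓘(ℝ, E) B)) (f q) :=
    hψ.clm_bundle_apply hext
  simp only at hψ' hs'
  set e := trivializationAt E (TangentSpace 𝓘(ℝ, E) : B → Type _) (f q) with he
  set A : B → E →L[ℝ] E := fun y ↦ ContinuousLinearMap.inCoordinates E
    (TangentSpace 𝓘(ℝ, E) : B → Type _) E (TangentSpace 𝓘(ℝ, E) : B → Type _)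
    (f q) y (f q) y (ψ y) with hA
  have hq : f q ∈ e.baseSet := mem_baseSet_trivializationAt' (f q)
  have hnhds : ∀ᶠ y in nhds (f q), y ∈ e.baseSet := e.open_baseSet.mem_nhds hq
  have hAe : ∀ y ∈ e.baseSet, ∀ u : TangentSpace 𝓘(ℝ, E) y,
      (e (⟨y, ψ y u⟩ : TangentBundle 𝓘(ℝ, E) B)).2 =
        A y (e (⟨y, u⟩ : TangentBundle 𝓘(ℝ, E) B)).2 :=
    fun y hy u ↦ trivializationAt_clm_apply hy hy (ψ y) u
  have hsymm : ∀ c : E, e.symm (f q) (A (f q) c) = ψ (f q) (e.symm (f q) c) :=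
    fun c ↦ trivializationAt_symm_inCoordinates hq hq (ψ (f q)) c
  have hadd : ∀ c d : E, e.symm (f q) (c + d) = e.symm (f q) c + e.symm (f q) d := by
    intro c d
    simp only [← e.symmL_apply (R := ℝ) hq, map_add]
  have h1 : (fun q' ↦ (e (⟨f q', ψ (f q') (s q')⟩ : TangentBundle 𝓘(ℝ, E) B)).2) =ᶠ[nhds q]
      fun q' ↦ A (f q') (e (⟨f q', s q'⟩ : TangentBundle 𝓘(ℝ, E) B)).2 := by
    filter_upwards [hf.continuousAt hnhds] with q' hq'
    exact hAe _ hq' _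
  have h2 : (fun y ↦ (e (⟨y, ψ y (extend E (s q) y)⟩ : TangentBundle 𝓘(ℝ, E) B)).2)
      =ᶠ[nhds (f q)] fun y ↦ A y (e (⟨f q, s q⟩ : TangentBundle 𝓘(ℝ, E) B)).2 := by
    filter_upwards [hnhds] with y hy
    rw [hAe y hy]
    congr 1
    exact e.apply_mk_symm hy _ ▸ rfl
  rw [cov_apply_eq_add cov hψext]
  simp only [covAlong]
  rw [← he, mvfderiv_congr_of_eventuallyEq h1, mvfderiv_congr_of_eventuallyEq h2,
    mvfderiv_clm_apply (A := fun q' ↦ A (f q')) (hψ'.comp q hf) hs',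
    mvfderiv_clm_apply hψ' mdifferentiableAt_const, mvfderiv_const,
    mvfderiv_comp_apply_vector hψ' hf]
  simp only [zero_apply, map_zero, add_zero, hadd, hsymm, map_add, extend_apply_self]
  abel

/-- Read in the chart at `x`, both fields are constant near the base point, and constant fields
commute. -/
theorem mlieBracket_extend_extend {x : B} (u v : TangentSpace 𝓘(ℝ, E) x) :
    VectorField.mlieBracket 𝓘(ℝ, E) (extend E u) (extend E v) x = 0 := by
  have : IsManifold 𝓘(ℝ, E) 1 B := .of_le (n := ∞) (by simp)
  have key : ∀ u : TangentSpace 𝓘(ℝ, E) x,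
      VectorField.mpullbackWithin 𝓘(ℝ, E) 𝓘(ℝ, E) (extChartAt 𝓘(ℝ, E) x).symm (extend E u)
        (Set.range 𝓘(ℝ, E)) =ᶠ[nhds (extChartAt 𝓘(ℝ, E) x x)] fun _ ↦
        ((trivializationAt E (TangentSpace 𝓘(ℝ, E) : B → Type _) x)
          (⟨x, u⟩ : TangentBundle 𝓘(ℝ, E) B)).2 := by
    intro u
    filter_upwards [extChartAt_target_mem_nhds x] with y hy
    have hy' : (extChartAt 𝓘(ℝ, E) x).symm y ∈ (chartAt E x).source := by
      simpa using (extChartAt 𝓘(ℝ, E) x).map_target hy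
    simp only [VectorField.mpullbackWithin_apply, extend]
    rw [← Bundle.Trivialization.symmL_apply (R := ℝ) _ (by simpa using hy'),
      TangentBundle.symmL_trivializationAt hy', (extChartAt 𝓘(ℝ, E) x).right_inv hy]
    exact (isInvertible_mfderivWithin_extChartAt_symm hy).inverse_apply_eq.2 rfl
  have hconst : ∀ {V₁ V₂ : E → E} {c d y : E}, V₁ =ᶠ[nhds y] (fun _ ↦ c) →
      V₂ =ᶠ[nhds y] (fun _ ↦ d) → VectorField.lieBracketWithin ℝ V₁ V₂
        ((extChartAt 𝓘(ℝ, E) x).symm ⁻¹' Set.univ ∩ Set.range 𝓘(ℝ, E)) y = 0 := by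
    intro V₁ V₂ c d y h₁ h₂
    rw [Set.preimage_univ, Set.univ_inter, ModelWithCorners.range_eq_univ,
      VectorField.lieBracketWithin_univ, h₁.lieBracket_vectorField_eq h₂]
    simp [VectorField.lieBracket]
  rw [← VectorField.mlieBracketWithin_univ, VectorField.mlieBracketWithin_apply]
  exact (congrArg _ (hconst (key u) (key v))).trans (map_zero _)

/-- Symmetry of the Christoffel symbols: coordinate fields commute, so zero torsion leaves only the
two covariant derivatives. -/
theorem cov_extend_apply_comm [FiniteDimensional ℝ E]
    {cov : CovariantDerivative 𝓘(ℝ, E) E (TangentSpace 𝓘(ℝ, E) : B → Type _)}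
    (hcov : cov.torsion = 0) {x : B} (u v : TangentSpace 𝓘(ℝ, E) x) :
    cov (extend E v) x u = cov (extend E u) x v := by
  have := cov.torsion_apply_eq_extend u v
  rw [hcov, mlieBracket_extend_extend] at this
  simp only [Pi.zero_apply, zero_apply, extend_apply_self, sub_zero] at this
  exact sub_eq_zero.1 this.symm

end Along
-- The antisymmetrized derivative of pushed-forward fields.
section Push

open FiberBundle

variable {E : Type*} [NormedAddCommGroup E] [NormedSpace ℝ E]
  {B : Type*} [TopologicalSpace B] [ChartedSpace E B]
  {F : Type*} [NormedAddCommGroup F] [NormedSpace ℝ F]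
  {N : Type*} [TopologicalSpace N] [ChartedSpace F N]

/-- The equality holds on a neighbourhood, not just at the base point, so it can be differentiated
once more: the derivative of the matrix of `df` is then a second derivative. -/
theorem inTangentCoordinates_mfderiv_comp_extChartAt_symm [IsManifold 𝓘(ℝ, E) 1 B]
    [IsManifold 𝓘(ℝ, F) 1 N] {f : N → B} (hf : ContMDiff 𝓘(ℝ, F) 𝓘(ℝ, E) 1 f) (p : N) :
    (inTangentCoordinates 𝓘(ℝ, F) 𝓘(ℝ, E) id f (mfderiv 𝓘(ℝ, F) 𝓘(ℝ, E) f) p) ∘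
        (extChartAt 𝓘(ℝ, F) p).symm =ᶠ[nhds (extChartAt 𝓘(ℝ, F) p p)]
      fderiv ℝ (extChartAt 𝓘(ℝ, E) (f p) ∘ f ∘ (extChartAt 𝓘(ℝ, F) p).symm) := by
  have hnear : ∀ᶠ y in nhds (extChartAt 𝓘(ℝ, F) p p),
      f ((extChartAt 𝓘(ℝ, F) p).symm y) ∈ (chartAt E (f p)).source := by
    have h1 : Filter.Tendsto (extChartAt 𝓘(ℝ, F) p).symm (nhds (extChartAt 𝓘(ℝ, F) p p))
        (nhds p) := by
      simpa using (continuousAt_extChartAt_symm (I := 𝓘(ℝ, F)) p).tendsto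
    exact (hf.continuous.continuousAt.tendsto.comp h1)
      ((chartAt E (f p)).open_source.mem_nhds (mem_chart_source E (f p)))
  filter_upwards [extChartAt_target_mem_nhds (I := 𝓘(ℝ, F)) p, hnear] with y hy hfy
  have hy' : (extChartAt 𝓘(ℝ, F) p).symm y ∈ (chartAt F p).source := by
    simpa using (extChartAt 𝓘(ℝ, F) p).map_target hy
  have hchi : MDifferentiableAt 𝓘(ℝ, F) 𝓘(ℝ, F) (extChartAt 𝓘(ℝ, F) p).symm y := by
    simpa [mdifferentiableWithinAt_univ] using
      mdifferentiableWithinAt_extChartAt_symm (I := 𝓘(ℝ, F)) hy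
  have hfd := (hf.mdifferentiable one_ne_zero) ((extChartAt 𝓘(ℝ, F) p).symm y)
  have hphi : MDifferentiableAt 𝓘(ℝ, E) 𝓘(ℝ, E) (extChartAt 𝓘(ℝ, E) (f p))
      (f ((extChartAt 𝓘(ℝ, F) p).symm y)) := mdifferentiableAt_extChartAt hfy
  have h0 := inTangentCoordinates_eq_mfderiv_comp (I := 𝓘(ℝ, F)) (I' := 𝓘(ℝ, E)) (f := id) (g := f)
    (ϕ := fun x ↦ mfderiv 𝓘(ℝ, F) 𝓘(ℝ, E) f x) (x₀ := p) hy' hfy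
  refine Eq.trans h0 ?_
  rw [← mfderiv_eq_fderiv, mfderiv_comp y (hphi) (hfd.comp y hchi), mfderiv_comp y hfd hchi]
  -- The base point in `h0` is the chart applied to its inverse at `y`, equal to `y` only through
  -- `right_inv`; hence the free point `z`.
  have hr : ∀ z : F, z = y → (mfderivWithin 𝓘(ℝ, F) 𝓘(ℝ, F) (extChartAt 𝓘(ℝ, F) p).symm
      (Set.range 𝓘(ℝ, F)) z : F →L[ℝ] F) =
        mfderiv 𝓘(ℝ, F) 𝓘(ℝ, F) (extChartAt 𝓘(ℝ, F) p).symm y := by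
    rintro z rfl
    rw [ModelWithCorners.range_eq_univ, mfderivWithin_univ]
  exact congrArg (fun T : F →L[ℝ] F ↦ (mfderiv 𝓘(ℝ, E) 𝓘(ℝ, E) (extChartAt 𝓘(ℝ, E) (f p))
    (f ((extChartAt 𝓘(ℝ, F) p).symm y)) : E →L[ℝ] E).comp
      ((mfderiv 𝓘(ℝ, F) 𝓘(ℝ, E) f ((extChartAt 𝓘(ℝ, F) p).symm y) : F →L[ℝ] E).comp T))
        (hr _ ((extChartAt 𝓘(ℝ, F) p).right_inv hy))

theorem contDiffAt_writtenInExtChartAt {f : N → B} (hf : ContMDiff 𝓘(ℝ, F) 𝓘(ℝ, E) ∞ f) (p : N) :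
    ContDiffAt ℝ ∞ (extChartAt 𝓘(ℝ, E) (f p) ∘ f ∘ (extChartAt 𝓘(ℝ, F) p).symm)
      (extChartAt 𝓘(ℝ, F) p p) := by
  have := (contMDiffAt_iff.1 (hf p)).2
  simpa only [modelWithCornersSelf_coe, Set.range_id, contDiffWithinAt_univ] using this

/-- With `A` the matrix of `df`, the coordinates of `∇_W f_* Y` are `dA(W) Y + A (dY(W))` plus a
Christoffel term. The first term is symmetric as a second derivative of `f`, the Christoffel term by
zero torsion. The difference is `A (dY(W) - dW(Y))`, a value of `df`. -/
theorem covAlong_push_sub_mem_rangeAt [FiniteDimensional ℝ E] [IsManifold 𝓘(ℝ, E) ∞ B]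
    [IsManifold 𝓘(ℝ, F) ∞ N]
    {cov : CovariantDerivative 𝓘(ℝ, E) E (TangentSpace 𝓘(ℝ, E) : B → Type _)}
    (hcov : cov.torsion = 0) {f : N → B} (hf : ContMDiff 𝓘(ℝ, F) 𝓘(ℝ, E) ∞ f)
    {W Y : Π q : N, TangentSpace 𝓘(ℝ, F) q} {p : N}
    (hW : MDifferentiableAt 𝓘(ℝ, F) 𝓘(ℝ, F).tangent
      (fun q ↦ (⟨q, W q⟩ : TangentBundle 𝓘(ℝ, F) N)) p)
    (hY : MDifferentiableAt 𝓘(ℝ, F) 𝓘(ℝ, F).tangent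
      (fun q ↦ (⟨q, Y q⟩ : TangentBundle 𝓘(ℝ, F) N)) p) :
    covAlong cov f (push E f Y) p (W p) - covAlong cov f (push E f W) p (Y p) ∈
      rangeAt F E f p := by
  have : IsManifold 𝓘(ℝ, E) 1 B := .of_le (n := ∞) (by simp)
  have : IsManifold 𝓘(ℝ, F) 1 N := .of_le (n := ∞) (by simp)
  set A := inTangentCoordinates 𝓘(ℝ, F) 𝓘(ℝ, E) id f (mfderiv 𝓘(ℝ, F) 𝓘(ℝ, E) f) p with hA
  have hAd : MDifferentiableAt 𝓘(ℝ, F) 𝓘(ℝ, F →L[ℝ] E) A p :=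
    ((hf p).mfderiv_const (m := 1) (by norm_cast)).mdifferentiableAt one_ne_zero
  have hfp := hf.continuous.continuousAt.preimage_mem_nhds
    ((chartAt E (f p)).open_source.mem_nhds (mem_chart_source E (f p)))
  have hcoord : ∀ X : Π q : N, TangentSpace 𝓘(ℝ, F) q,
      (fun q ↦ ((trivializationAt E (TangentSpace 𝓘(ℝ, E) : B → Type _) (f p))
        (⟨f q, push E f X q⟩ : TangentBundle 𝓘(ℝ, E) B)).2) =ᶠ[nhds p] fun q ↦ A q
        ((trivializationAt F (TangentSpace 𝓘(ℝ, F) : N → Type _) p)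
          (⟨q, X q⟩ : TangentBundle 𝓘(ℝ, F) N)).2 := by
    intro X
    filter_upwards [hfp, (chartAt F p).open_source.mem_nhds (mem_chart_source F p)] with q hq hq'
    exact trivializationAt_clm_apply hq' hq _ _
  have hsymm : ∀ u v : F, mvfderiv 𝓘(ℝ, F) A p u v = mvfderiv 𝓘(ℝ, F) A p v u := by
    intro u v
    rw [mvfderiv_eq_fderiv hAd,
      (inTangentCoordinates_mfderiv_comp_extChartAt_symm (hf.of_le (by simp)) p).fderiv_eq]
    exact (contDiffAt_writtenInExtChartAt hf p).isSymmSndFDerivAt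
      (by rw [minSmoothness_of_isRCLikeNormedField]; exact WithTop.coe_le_coe.2 le_top) u v
  have hWc := (mdifferentiableAt_section 𝓘(ℝ, F) W).1 hW
  have hYc := (mdifferentiableAt_section 𝓘(ℝ, F) Y).1 hY
  have hb : f p ∈ (trivializationAt E (TangentSpace 𝓘(ℝ, E) : B → Type _) (f p)).baseSet :=
    mem_baseSet_trivializationAt' (f p)
  simp only [covAlong]
  rw [mvfderiv_congr_of_eventuallyEq (hcoord W), mvfderiv_congr_of_eventuallyEq (hcoord Y),
    mvfderiv_clm_apply hAd hWc, mvfderiv_clm_apply hAd hYc, trivializationAt_apply_self,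
    trivializationAt_apply_self, hsymm (Y p) (W p)]
  have hcomm : cov (extend E (push E f Y p)) (f p) (mfderiv 𝓘(ℝ, F) 𝓘(ℝ, E) f p (W p)) =
      cov (extend E (push E f W p)) (f p) (mfderiv 𝓘(ℝ, F) 𝓘(ℝ, E) f p (Y p)) :=
    cov_extend_apply_comm hcov _ _
  rw [hcomm]
  simp only [← Bundle.Trivialization.symmL_apply (R := ℝ) _ hb, map_add]
  -- The Christoffel terms and then the second-derivative terms cancel.
  rw [add_sub_add_right_eq_sub, add_sub_add_left_eq_sub, ← map_sub, ← map_sub]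
  rw [Bundle.Trivialization.symmL_apply (R := ℝ) _ hb]
  exact ⟨_, (trivializationAt_symm_inCoordinates (mem_chart_source F p) (mem_chart_source E (f p))
    (mfderiv 𝓘(ℝ, F) 𝓘(ℝ, E) f p) _).symm⟩

end Push
end ClairautMap

/-! ### Orthogonality in one tangent space, and the main theorem. -/

theorem ClairautMap.inner_psi_starProjection_psi_eq_zero
    {T : Type*} [NormedAddCommGroup T] [InnerProductSpace ℝ T]
    {R : Submodule ℝ T} [R.HasOrthogonalProjection] {ψ : T →ₗ[ℝ] T} {ξ : T}
    (hψ : ∀ v w, (inner ℝ (ψ v) (ψ w) : ℝ) = inner ℝ v w - inner ℝ v ξ * inner ℝ w ξ)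
    (hanti : ∀ v ∈ R, ψ v ∈ Rᗮ) (hξ : ξ ∈ Rᗮ) {v U : T} (hv : v ∈ R) (hU : U ∈ Rᗮ) :
    (inner ℝ (Rᗮ.starProjection (ψ v)) (Rᗮ.starProjection (ψ U)) : ℝ) = 0 := by
  -- Self-adjointness and idempotence leave one projection, placed on `ψ v`, which is already
  -- normal; the metric identity for `ψ` then applies.
  rw [Submodule.inner_starProjection_left_eq_right,
    Submodule.starProjection_eq_self_iff.2 (Submodule.starProjection_apply_mem _ _),
    ← Submodule.inner_starProjection_left_eq_right,
    Submodule.starProjection_eq_self_iff.2 (hanti v hv), hψ, hU v hv, hξ v hv]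
  ring

theorem theorem3p5
    {E₁ : Type*} [NormedAddCommGroup E₁] [NormedSpace ℝ E₁] [FiniteDimensional ℝ E₁]
    {M : Type*} [TopologicalSpace M] [T2Space M] [SecondCountableTopology M]
    [ChartedSpace E₁ M] [IsManifold 𝓘(ℝ, E₁) ∞ M]
    [RiemannianBundle (fun x : M ↦ TangentSpace 𝓘(ℝ, E₁) x)]
    [IsContMDiffRiemannianBundle 𝓘(ℝ, E₁) ∞ E₁ (fun x : M ↦ TangentSpace 𝓘(ℝ, E₁) x)]
    {E : Type*} [NormedAddCommGroup E] [NormedSpace ℝ E] [FiniteDimensional ℝ E]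
    {B : Type*} [TopologicalSpace B] [T2Space B] [SecondCountableTopology B]
    [ChartedSpace E B] [IsManifold 𝓘(ℝ, E) ∞ B]
    [RiemannianBundle (fun x : B ↦ TangentSpace 𝓘(ℝ, E) x)]
    [IsContMDiffRiemannianBundle 𝓘(ℝ, E) ∞ E (fun x : B ↦ TangentSpace 𝓘(ℝ, E) x)]
    (cov : CovariantDerivative 𝓘(ℝ, E) E (TangentSpace 𝓘(ℝ, E) : B → Type _))
    (hcov : ClairautMap.IsLeviCivita cov)
    (ψ : Π x : B, TangentSpace 𝓘(ℝ, E) x →L[ℝ] TangentSpace 𝓘(ℝ, E) x)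
    (ξ : Π x : B, TangentSpace 𝓘(ℝ, E) x)
    (η : Π x : B, TangentSpace 𝓘(ℝ, E) x →L[ℝ] ℝ)
    (α β : B → ℝ)
    (hB : ClairautMap.IsTransSasakian cov ψ ξ η α β)
    (f : M → B)
    (hmap : ClairautMap.IsRiemannianMap (E₁ := E₁) (E := E) f)
    (hanti : ClairautMap.IsAntiInvariant (E₁ := E₁) f ψ)
    (hclairaut : ClairautMap.IsClairaut (E₁ := E₁) cov f)
    (hξ : ∀ p : M, ξ (f p) ∈ (ClairautMap.rangeAt E₁ E f p)ᗮ)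
    (hint : ClairautMap.IsIntegrableRange E₁ E f)
    (W Y : Π p : M, TangentSpace 𝓘(ℝ, E₁) p)
    (hW : ClairautMap.IsHorizontalField E f W)
    (hY : ClairautMap.IsHorizontalField E f Y)
    (p : M) (U : TangentSpace 𝓘(ℝ, E) (f p))
    (hU : U ∈ (ClairautMap.rangeAt E₁ E f p)ᗮ) :
    (inner ℝ
      (ClairautMap.normalCov cov f (fun q ↦ ψ (f q) (ClairautMap.push E f Y q)) p (W p)
        - ClairautMap.normalCov cov f (fun q ↦ ψ (f q) (ClairautMap.push E f W q)) p (Y p))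
      (ClairautMap.normalPart E₁ f ψ p U) : ℝ) = 0 := by
  have hpf : MDifferentiableAt 𝓘(ℝ, E₁) 𝓘(ℝ, E) f p :=
    hmap.smooth.mdifferentiable (by simp) p
  have hpush : ∀ {X : Π p : M, TangentSpace 𝓘(ℝ, E₁) p}, ClairautMap.IsHorizontalField E f X →
      MDifferentiableAt 𝓘(ℝ, E₁) 𝓘(ℝ, E).tangent
        (fun q ↦ (⟨f q, ClairautMap.push E f X q⟩ : TangentBundle 𝓘(ℝ, E) B)) p := by
    intro X hX
    have h := (hmap.smooth.contMDiff_tangentMap (m := ∞) (by simp)).comp hX.smooth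
    exact h.mdifferentiable (by simp) p
  have hcovψ : ∀ {X : Π p : M, TangentSpace 𝓘(ℝ, E₁) p}, ClairautMap.IsHorizontalField E f X →
      ∀ w : TangentSpace 𝓘(ℝ, E₁) p,
      ClairautMap.covAlong cov f (fun q ↦ ψ (f q) (ClairautMap.push E f X q)) p w =
        ψ (f p) (ClairautMap.covAlong cov f (ClairautMap.push E f X) p w) +
          α (f p) • (inner ℝ (mfderiv 𝓘(ℝ, E₁) 𝓘(ℝ, E) f p w)
            (ClairautMap.push E f X p) : ℝ) • ξ (f p) := by
    intro X hX w
    have hXr : ClairautMap.push E f X p ∈ ClairautMap.rangeAt E₁ E f p := ⟨_, rfl⟩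
    have hwr : mfderiv 𝓘(ℝ, E₁) 𝓘(ℝ, E) f p w ∈ ClairautMap.rangeAt E₁ E f p := ⟨_, rfl⟩
    have h1 : (inner ℝ (ClairautMap.push E f X p) (ξ (f p)) : ℝ) = 0 := hξ p _ hXr
    have h2 : (inner ℝ (ψ (f p) (mfderiv 𝓘(ℝ, E₁) 𝓘(ℝ, E) f p w))
        (ClairautMap.push E f X p) : ℝ) = 0 := by
      rw [real_inner_comm]
      exact hanti p _ hwr _ hXr
    -- Of the four terms in `cov_psi`, `h1` kills both with `η` and `h2` kills the remaining `β`
    -- term.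
    rw [ClairautMap.covAlong_endomorphism_apply cov (hB.smooth_psi.mdifferentiable (by simp) _)
      hpf (hpush hX), hB.cov_psi _ _ _ (FiberBundle.mdifferentiableAt_extend 𝓘(ℝ, E) E _)]
    simp [hB.eta_eq_inner, h1, h2]
  have hmem := ClairautMap.covAlong_push_sub_mem_rangeAt hcov.torsion_eq_zero hmap.smooth
    (hW.smooth.mdifferentiable (by simp) p) (hY.smooth.mdifferentiable (by simp) p)
  have hsub : ClairautMap.covAlong cov f (fun q ↦ ψ (f q) (ClairautMap.push E f Y q)) p (W p) -
      ClairautMap.covAlong cov f (fun q ↦ ψ (f q) (ClairautMap.push E f W q)) p (Y p) =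
      ψ (f p) (ClairautMap.covAlong cov f (ClairautMap.push E f Y) p (W p) -
        ClairautMap.covAlong cov f (ClairautMap.push E f W) p (Y p)) := by
    -- The two multiples of `ξ` agree by symmetry of the metric, so they cancel in the difference.
    have hcomm : (inner ℝ (mfderiv 𝓘(ℝ, E₁) 𝓘(ℝ, E) f p (W p)) (ClairautMap.push E f Y p) : ℝ) =
        inner ℝ (mfderiv 𝓘(ℝ, E₁) 𝓘(ℝ, E) f p (Y p)) (ClairautMap.push E f W p) :=
      real_inner_comm _ _
    rw [hcovψ hY, hcovψ hW, hcomm, map_sub]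
    abel
  simp only [ClairautMap.normalCov, ClairautMap.normalPart]
  rw [← map_sub, hsub]
  refine ClairautMap.inner_psi_starProjection_psi_eq_zero (ψ := (ψ (f p)).toLinearMap)
    (ξ := ξ (f p)) (fun v w ↦ ?_) (hanti p) (hξ p) hmem hU
  have h := hB.inner_psi_psi (f p) v w
  rw [hB.eta_eq_inner, hB.eta_eq_inner] at h
  exact h
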